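/- For integers $d\ge 1$ and $k\ge 2d$, let $K_{k/d}$ be the circular complete graph: its vertices are $0,1,\dots,k-1$, and $i,j$ are adjacent if and only if $d\le |i-j|\le k-d$. Let $\overline{G}$ denote the complement of a graph $G$. For a finite graph $G=(V,E)$ let $$\vartheta(G)=\max\Big\{\sum_{(x,y)\in V^2}B(x,y)\ :\ B\in\mathbb{R}^{V\times V}\text{ symmetric positive semidefinite},\ \sum_{x\in V}B(x,x)=1,\ B(x,y)=0\text{ for all } xy\in E\Big\}$$ be its Lovász theta number. **Theorem.** Let $k,d,k',d'$ be integers with $d,d'\ge 1$, $k\ge 2d$ and $k'\ge 2d'$. If $\vartheta(\overline{K_{k/d}})=\vartheta(\overline{K_{k'/d'}})$, then $k/d=k'/d'$. -/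

import Mathlib

/-- The circular complete graph `K_{k/d}`: its vertices are `0, 1, …, k - 1`, and two distinct
vertices `i`, `j` are adjacent iff `d ≤ |i - j| ≤ k - d` (computed in the integers).
For `1 ≤ d` the requirement that `i` and `j` be distinct is redundant. -/
def circularCompleteGraph (k d : ℕ) : SimpleGraph (Fin k) where
  Adj i j := i ≠ j ∧ (d : ℤ) ≤ |(i : ℤ) - (j : ℤ)| ∧ |(i : ℤ) - (j : ℤ)| ≤ (k : ℤ) - (d : ℤ)
  symm := ⟨fun i j h => ⟨h.1.symm, by rw [abs_sub_comm]; exact h.2⟩⟩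
  loopless := ⟨fun _ h => h.1 rfl⟩

/-- The feasible matrices of the semidefinite program defining the theta number of `G`: real
symmetric positive semidefinite matrices of trace one, vanishing on the edges of `G`. -/
def thetaFeasible {V : Type*} [Fintype V] (G : SimpleGraph V) : Set (Matrix V V ℝ) :=
  {B | B.PosSemidef ∧ ∑ x, B x x = 1 ∧ ∀ x y, G.Adj x y → B x y = 0}

/-- The Lovász theta number of a finite graph: the maximum of the sum of all the entries of `B`,
over the feasible matrices `B`. -/
noncomputable def lovaszTheta {V : Type*} [Fintype V] (G : SimpleGraph V) : ℝ :=
  sSup ((fun B : Matrix V V ℝ => ∑ x, ∑ y, B x y) '' thetaFeasible G)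

/-- The feasible region is compact. -/
theorem isCompact_thetaFeasible {V : Type*} [Fintype V] (G : SimpleGraph V) :
    IsCompact (thetaFeasible G) := by
  classical
  have hsub : thetaFeasible G ⊆
      Set.univ.pi fun _ : V => Set.univ.pi fun _ : V => Set.Icc (-1 : ℝ) 1 := by
    rintro B ⟨hB, htr, -⟩ x - y -
    have hdiag : ∀ z, 0 ≤ B z z := fun z => hB.diag_nonneg
    have hle : ∀ z, B z z ≤ 1 := fun z => by
      rw [← htr]
      exact Finset.single_le_sum (f := fun w => B w w) (fun w _ => hdiag w) (Finset.mem_univ z)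
    have hsymm : B y x = B x y := by simpa using hB.1.apply x y
    have hp := hB.dotProduct_mulVec_nonneg (Pi.single x 1 + Pi.single y 1)
    have hm := hB.dotProduct_mulVec_nonneg (Pi.single x 1 - Pi.single y 1)
    simp [Matrix.mulVec_add, Matrix.mulVec_sub, add_dotProduct, sub_dotProduct,
      hsymm] at hp hm
    have h1 := hle x
    have h2 := hle y
    constructor <;> linarith
  refine (isCompact_univ_pi fun _ => isCompact_univ_pi fun _ => isCompact_Icc).of_isClosed_subset
    ?_ hsub
  have hset : thetaFeasible G =
      {B : Matrix V V ℝ | B.transpose = B} ∩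
      ((⋂ v : V → ℝ, {B : Matrix V V ℝ | 0 ≤ dotProduct v (B.mulVec v)}) ∩
      ({B : Matrix V V ℝ | ∑ x, B x x = 1} ∩
      ⋂ x, ⋂ y, ⋂ _ : G.Adj x y, {B : Matrix V V ℝ | B x y = 0})) := by
    ext B
    simp [thetaFeasible, Matrix.posSemidef_iff_dotProduct_mulVec, Matrix.IsHermitian,
      Matrix.conjTranspose_eq_transpose_of_trivial, and_assoc]
  rw [hset]
  refine IsClosed.inter (isClosed_eq (by fun_prop) (by fun_prop)) (IsClosed.inter
    (isClosed_iInter fun v => isClosed_le continuous_const ?_)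
    (IsClosed.inter (isClosed_eq ?_ continuous_const)
    (isClosed_iInter fun x => isClosed_iInter fun y => isClosed_iInter fun _ =>
      isClosed_eq ?_ continuous_const)))
  · fun_prop
  · fun_prop
  · fun_prop

/-- On a nonempty vertex set the supremum in `lovaszTheta` is an attained maximum. -/
theorem isGreatest_lovaszTheta {V : Type*} [Fintype V] [Nonempty V] (G : SimpleGraph V) :
    IsGreatest ((fun B : Matrix V V ℝ => ∑ x, ∑ y, B x y) '' thetaFeasible G)
      (lovaszTheta G) := by
  classical
  have hcpt := (isCompact_thetaFeasible G).image
    (f := fun B : Matrix V V ℝ => ∑ x, ∑ y, B x y) (by fun_prop)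
  refine hcpt.isGreatest_sSup (Set.Nonempty.image _ ?_)
  obtain ⟨v⟩ := ‹Nonempty V›
  refine ⟨Matrix.diagonal (Pi.single v 1), Matrix.PosSemidef.diagonal ?_, ?_, ?_⟩
  · exact Pi.single_nonneg.2 zero_le_one
  · simp
  · intro x y h
    exact Matrix.diagonal_apply_ne _ h.ne

/-! Write θ̄(G) for the theta number of the complement of G. The point is that θ̄(K_{k/d}) is
strictly increasing in k/d. Weak monotonicity holds because feasible matrices push forward along
homomorphisms. For strictness, given k/d < k'/d', insert G = K_{(mk'+1)/(md'+1)} with m large, whose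
ratio lies between the two. There are k' floor homomorphisms from G to H = K_{k'/d'}. Push a
rotation-invariant optimal matrix of G along each and average: the result is feasible for H with
value θ̄(G). A vector v in its kernel has sum zero along every homomorphism
(`sum_eq_zero_of_dotProduct_mulVec_eq_zero`), and consecutive homomorphisms differ at one vertex, so
v is constant, hence zero (`eq_of_sum_circularHom_eq_zero`). The average is thus positive definite,
and a small increase on an edge of H improves it (`sum_lt_lovaszTheta_of_posDef`). -/

/-! ### Pushing feasible matrices along homomorphisms. -/

/-- Push a matrix forward along a map of the index sets, by summing over the fibres. -/
def pushMatrix {V W : Type*} [Fintype V] [DecidableEq W] (f : V → W) (B : Matrix V V ℝ) :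
    Matrix W W ℝ :=
  Matrix.of fun u v => ∑ x, ∑ y, if f x = u ∧ f y = v then B x y else 0

section Theta

open Matrix

variable {V W : Type*} [Fintype V] [Fintype W]

theorem sum_mul_pushMatrix [DecidableEq W] (f : V → W) (B : Matrix V V ℝ) (a b : W → ℝ) :
    ∑ u, ∑ v, a u * pushMatrix f B u v * b v = ∑ x, ∑ y, a (f x) * B x y * b (f y) := by
  simp only [pushMatrix, of_apply, Finset.mul_sum, Finset.sum_mul]
  calc ∑ u, ∑ v, ∑ x, ∑ y, a u * (if f x = u ∧ f y = v then B x y else 0) * b v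
      = ∑ u, ∑ x, ∑ v, ∑ y, a u * (if f x = u ∧ f y = v then B x y else 0) * b v :=
        Finset.sum_congr rfl fun u _ => Finset.sum_comm
    _ = ∑ x, ∑ u, ∑ y, ∑ v, a u * (if f x = u ∧ f y = v then B x y else 0) * b v := by
        rw [Finset.sum_comm]
        exact Finset.sum_congr rfl fun x _ => Finset.sum_congr rfl fun u _ => Finset.sum_comm
    _ = ∑ x, ∑ y, ∑ u, ∑ v, a u * (if f x = u ∧ f y = v then B x y else 0) * b v :=
        Finset.sum_congr rfl fun x _ => Finset.sum_comm
    _ = _ := by simp [ite_and]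

theorem dotProduct_mulVec_eq_sum (a b : V → ℝ) (B : Matrix V V ℝ) :
    a ⬝ᵥ (B *ᵥ b) = ∑ x, ∑ y, a x * B x y * b y := by
  simp [dotProduct, mulVec, Finset.mul_sum, mul_assoc]

theorem dotProduct_pushMatrix_mulVec [DecidableEq W] (f : V → W) (B : Matrix V V ℝ) (v : W → ℝ) :
    v ⬝ᵥ (pushMatrix f B *ᵥ v) = (v ∘ f) ⬝ᵥ (B *ᵥ (v ∘ f)) := by
  simp only [dotProduct_mulVec_eq_sum, sum_mul_pushMatrix, Function.comp]

theorem sum_pushMatrix [DecidableEq W] (f : V → W) (B : Matrix V V ℝ) :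
    ∑ u, ∑ v, pushMatrix f B u v = ∑ x, ∑ y, B x y := by
  simpa using sum_mul_pushMatrix f B 1 1

theorem posSemidef_pushMatrix [DecidableEq W] (f : V → W) {B : Matrix V V ℝ}
    (hB : B.PosSemidef) : (pushMatrix f B).PosSemidef := by
  refine PosSemidef.of_dotProduct_mulVec_nonneg ?_ fun v => ?_
  · ext u v
    simp only [conjTranspose_apply, pushMatrix, of_apply, star_trivial]
    rw [Finset.sum_comm]
    refine Finset.sum_congr rfl fun x _ => Finset.sum_congr rfl fun y _ => ?_
    have h : B y x = B x y := by simpa using hB.1.apply x y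
    simp only [h, and_comm]
  · rw [star_trivial, dotProduct_pushMatrix_mulVec]
    simpa using hB.dotProduct_mulVec_nonneg (v ∘ f)

/-- A graph homomorphism `G → H` pushes feasible matrices for the complement of `G` forward to
feasible matrices for the complement of `H`. -/
theorem pushMatrix_mem_thetaFeasible [DecidableEq W] {G : SimpleGraph V} {H : SimpleGraph W}
    (f : G →g H) {B : Matrix V V ℝ} (hB : B ∈ thetaFeasible Gᶜ) :
    pushMatrix f B ∈ thetaFeasible Hᶜ := by
  classical
  obtain ⟨hpos, htr, hz⟩ := hB
  -- This covers `f x = f y` too: fibres are independent in `G`, so only diagonal entries of `B`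
  -- reach the diagonal and the trace is kept.
  have key : ∀ x y, ¬ H.Adj (f x) (f y) → B x y = if x = y then B x x else 0 := by
    intro x y h
    split_ifs with hxy
    · rw [hxy]
    · exact hz x y ((SimpleGraph.compl_adj _ _ _).2 ⟨hxy, fun hG => h (f.map_adj hG)⟩)
  refine ⟨posSemidef_pushMatrix f hpos, ?_, fun u v huv => ?_⟩
  · rw [← htr]
    simp only [pushMatrix, of_apply]
    rw [Finset.sum_comm]
    refine Finset.sum_congr rfl fun x _ => ?_
    rw [Finset.sum_comm]
    have : ∀ y, (∑ u, if f x = u ∧ f y = u then B x y else 0) = if x = y then B x x else 0 := by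
      intro y
      simp only [ite_and, Finset.sum_ite_eq, Finset.mem_univ, if_true]
      by_cases h : f y = f x
      · rw [if_pos h, key x y (by rw [h]; exact H.irrefl)]
      · rw [if_neg h, if_neg (by rintro rfl; exact h rfl)]
    simp [this]
  · rw [SimpleGraph.compl_adj] at huv
    refine Finset.sum_eq_zero fun x _ => Finset.sum_eq_zero fun y _ => ?_
    split_ifs with h
    · rw [key x y (by rw [h.1, h.2]; exact huv.2), if_neg]
      rintro rfl
      exact huv.1 (h.1.symm.trans h.2)
    · rfl

/-! ### Averaging, and monotonicity of the theta number. -/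

theorem convex_thetaFeasible (G : SimpleGraph V) : Convex ℝ (thetaFeasible G) := by
  rintro A ⟨hA, hAt, hAz⟩ B ⟨hB, hBt, hBz⟩ a b ha hb hab
  refine ⟨(hA.smul ha).add (hB.smul hb), ?_, fun x y h => ?_⟩
  · simp [Finset.sum_add_distrib, ← Finset.mul_sum, hAt, hBt, hab]
  · simp [hAz x y h, hBz x y h]

theorem average_mem_thetaFeasible {ι : Type*} [Fintype ι] [Nonempty ι] {G : SimpleGraph V}
    {M : ι → Matrix V V ℝ} (hM : ∀ i, M i ∈ thetaFeasible G) :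
    ∑ i, (Fintype.card ι : ℝ)⁻¹ • M i ∈ thetaFeasible G :=
  (convex_thetaFeasible G).sum_mem (fun _ _ => by positivity) (by simp) fun i _ => hM i

theorem sum_average {ι : Type*} [Fintype ι] [Nonempty ι] {M : ι → Matrix V V ℝ} {c : ℝ}
    (hM : ∀ i, ∑ x, ∑ y, M i x y = c) :
    ∑ x, ∑ y, (∑ i, (Fintype.card ι : ℝ)⁻¹ • M i) x y = c := by
  simp only [Matrix.sum_apply, Matrix.smul_apply, smul_eq_mul]
  calc _ = ∑ i, (Fintype.card ι : ℝ)⁻¹ * ∑ x, ∑ y, M i x y := by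
        simp only [Finset.mul_sum]
        exact (Finset.sum_congr rfl fun x _ => Finset.sum_comm).trans Finset.sum_comm
    _ = c := by simp [hM]

theorem le_lovaszTheta [Nonempty V] {G : SimpleGraph V} {B : Matrix V V ℝ}
    (hB : B ∈ thetaFeasible G) : ∑ x, ∑ y, B x y ≤ lovaszTheta G :=
  (isGreatest_lovaszTheta G).2 ⟨B, hB, rfl⟩

theorem exists_sum_eq_lovaszTheta [Nonempty V] (G : SimpleGraph V) :
    ∃ B ∈ thetaFeasible G, ∑ x, ∑ y, B x y = lovaszTheta G :=
  (isGreatest_lovaszTheta G).1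

theorem lovaszTheta_pos [Nonempty V] (G : SimpleGraph V) : 0 < lovaszTheta G := by
  classical
  obtain ⟨v⟩ := ‹Nonempty V›
  have h : (Matrix.diagonal (Pi.single v 1) : Matrix V V ℝ) ∈ thetaFeasible G := by
    refine ⟨Matrix.PosSemidef.diagonal (Pi.single_nonneg.2 zero_le_one), by simp, ?_⟩
    intro x y h
    exact Matrix.diagonal_apply_ne _ h.ne
  have := le_lovaszTheta h
  simp [Matrix.diagonal_apply] at this
  linarith

/-- Sandwich monotonicity: the theta number of the complement increases along homomorphisms. -/
theorem lovaszTheta_compl_le_of_hom [Nonempty V] [Nonempty W] {G : SimpleGraph V}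
    {H : SimpleGraph W} (f : G →g H) : lovaszTheta Gᶜ ≤ lovaszTheta Hᶜ := by
  classical
  obtain ⟨B, hB, hs⟩ := exists_sum_eq_lovaszTheta Gᶜ
  rw [← hs, ← sum_pushMatrix f B]
  exact le_lovaszTheta (pushMatrix_mem_thetaFeasible f hB)

/-! ### Strict increase from positive definiteness. -/

/-- Compactness of the unit sphere (of the sup norm) and homogeneity; `c` measures how far `B` may
be perturbed. -/
theorem Matrix.PosDef.exists_pos_forall_le {B : Matrix V V ℝ} (hB : B.PosDef) :
    ∃ c > 0, ∀ v : V → ℝ, c * ‖v‖ ^ 2 ≤ v ⬝ᵥ (B *ᵥ v) := by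
  rcases isEmpty_or_nonempty V with hV | hV
  · exact ⟨1, one_pos, fun v => by simp [Subsingleton.elim v 0]⟩
  obtain ⟨w, hw, hmin⟩ := (isCompact_sphere (0 : V → ℝ) 1).exists_isMinOn
    (NormedSpace.sphere_nonempty.2 zero_le_one)
    (f := fun v => v ⬝ᵥ (B *ᵥ v)) (by fun_prop)
  have hw0 : w ≠ 0 := by
    rintro rfl
    simp at hw
  refine ⟨w ⬝ᵥ (B *ᵥ w), by simpa using hB.dotProduct_mulVec_pos hw0, fun v => ?_⟩
  rcases eq_or_ne v 0 with rfl | hv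
  · simp
  have hn : 0 < ‖v‖ := norm_pos_iff.2 hv
  have h : w ⬝ᵥ (B *ᵥ w) ≤ (‖v‖⁻¹ • v) ⬝ᵥ (B *ᵥ (‖v‖⁻¹ • v)) :=
    hmin (by simp [norm_smul, hn.ne'])
  rw [mulVec_smul, dotProduct_smul, smul_dotProduct, smul_eq_mul, smul_eq_mul] at h
  calc _ ≤ ‖v‖⁻¹ * (‖v‖⁻¹ * v ⬝ᵥ (B *ᵥ v)) * ‖v‖ ^ 2 := by gcongr
    _ = _ := by field_simp

/-- A positive definite feasible matrix is not optimal when the zero pattern allows some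
off-diagonal entry. -/
theorem sum_lt_lovaszTheta_of_posDef [Nonempty V] {G : SimpleGraph V} {B : Matrix V V ℝ}
    (hB : B ∈ thetaFeasible Gᶜ) (hpd : B.PosDef) {a b : V} (hab : G.Adj a b) :
    ∑ x, ∑ y, B x y < lovaszTheta Gᶜ := by
  classical
  obtain ⟨c, hc, hle⟩ := hpd.exists_pos_forall_le
  obtain ⟨hpos, htr, hz⟩ := hB
  -- The form of `E` is `c * v a * v b`, at least `-c * ‖v‖ ^ 2`, which `B` absorbs, while the entry
  -- sum grows by `c`.
  set E : Matrix V V ℝ := Matrix.single a b (c / 2) + Matrix.single b a (c / 2) with hE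
  have hsum : ∑ x, ∑ y, E x y = c := by
    simp [hE, Matrix.single_apply, Finset.sum_add_distrib, ite_and]
  have hquad : ∀ v : V → ℝ, v ⬝ᵥ (E *ᵥ v) = c * (v a * v b) := by
    intro v
    simp [hE, add_mulVec, single_mulVec, Function.update_apply, dotProduct, mul_add,
      Finset.sum_add_distrib]
    ring
  have hmem : B + E ∈ thetaFeasible Gᶜ := by
    refine ⟨PosSemidef.of_dotProduct_mulVec_nonneg (hpos.1.add ?_) fun v => ?_, ?_, ?_⟩
    · simp [hE, Matrix.IsHermitian, add_comm]
    · rw [star_trivial, add_mulVec, dotProduct_add, hquad]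
      have ha : |v a| ≤ ‖v‖ := norm_le_pi_norm v a
      have hb : |v b| ≤ ‖v‖ := norm_le_pi_norm v b
      have h1 : |v a * v b| ≤ ‖v‖ ^ 2 := by
        rw [abs_mul, sq]
        gcongr
      have h2 := hle v
      have h3 := neg_abs_le (v a * v b)
      nlinarith
    · have : ∀ x, E x x = 0 := by
        intro x
        have := hab.ne
        simp [hE, Matrix.single_apply]
        grind
      simp [this, htr]
    · intro x y hxy
      rw [Matrix.add_apply, hz x y hxy, zero_add]
      rw [SimpleGraph.compl_adj] at hxy
      have h1 : ¬ (a = x ∧ b = y) := by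
        rintro ⟨rfl, rfl⟩
        exact hxy.2 hab
      have h2 : ¬ (b = x ∧ a = y) := by
        rintro ⟨rfl, rfl⟩
        exact hxy.2 hab.symm
      simp [hE, h1, h2]
  have := le_lovaszTheta hmem
  simp only [Matrix.add_apply, Finset.sum_add_distrib, hsum] at this
  linarith

/-- Semidefiniteness gives `B *ᵥ v = 0`; pairing with the all-ones vector, a left eigenvector for
`r`, gives the claim. -/
theorem sum_eq_zero_of_dotProduct_mulVec_eq_zero {B : Matrix V V ℝ} (hB : B.PosSemidef) {r : ℝ}
    (hr : r ≠ 0) (hrow : ∀ y, ∑ x, B x y = r) {v : V → ℝ} (hv : v ⬝ᵥ (B *ᵥ v) = 0) :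
    ∑ x, v x = 0 := by
  have h0 : B *ᵥ v = 0 := (hB.dotProduct_mulVec_zero_iff v).1 (by simpa using hv)
  have h1 : ∑ x, (B *ᵥ v) x = r * ∑ x, v x := by
    simp only [mulVec, dotProduct]
    rw [Finset.sum_comm, Finset.mul_sum]
    exact Finset.sum_congr rfl fun y _ => by rw [← Finset.sum_mul, hrow]
  simpa [h0, hr] using h1

/-- If sums of `v` over the fibres of the homs determine `v`, and `G` has an optimal matrix with
constant column sums, then the theta number of the complement increases strictly. -/
theorem lovaszTheta_compl_lt_of_homs {ι : Type*} [Fintype ι] [Nonempty ι] [Nonempty V] [Nonempty W]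
    {G : SimpleGraph V} {H : SimpleGraph W} (f : ι → G →g H)
    (hf : ∀ v : W → ℝ, (∀ i, ∑ x, v (f i x) = 0) → v = 0)
    {B : Matrix V V ℝ} (hB : B ∈ thetaFeasible Gᶜ) (hopt : ∑ x, ∑ y, B x y = lovaszTheta Gᶜ)
    {r : ℝ} (hr : r ≠ 0) (hrow : ∀ y, ∑ x, B x y = r) {a b : W} (hab : H.Adj a b) :
    lovaszTheta Gᶜ < lovaszTheta Hᶜ := by
  classical
  have hM := average_mem_thetaFeasible fun i => pushMatrix_mem_thetaFeasible (f i) hB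
  rw [← hopt, ← sum_average fun i => sum_pushMatrix (f i) B]
  refine sum_lt_lovaszTheta_of_posDef hM ?_ hab
  refine PosDef.of_dotProduct_mulVec_pos hM.1.1 fun v hv => ?_
  refine lt_of_le_of_ne (hM.1.dotProduct_mulVec_nonneg v) fun h0 => hv (hf v fun i => ?_)
  rw [star_trivial, sum_mulVec, dotProduct_sum, eq_comm,
    Finset.sum_eq_zero_iff_of_nonneg] at h0
  · have h1 := h0 i (Finset.mem_univ i)
    rw [smul_mulVec, dotProduct_smul, dotProduct_pushMatrix_mulVec, smul_eq_mul,
      mul_eq_zero] at h1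
    exact sum_eq_zero_of_dotProduct_mulVec_eq_zero hB.1 hr hrow
      (h1.resolve_left (by positivity))
  · intro i _
    rw [smul_mulVec, dotProduct_smul, dotProduct_pushMatrix_mulVec]
    exact smul_nonneg (by positivity) (by simpa using hB.1.dotProduct_mulVec_nonneg (v ∘ f i))

/-- A group acting regularly by automorphisms yields an optimal matrix with constant column sums. -/
theorem exists_optimal_const_sum [Nonempty V] [AddCommGroup V] {G : SimpleGraph V}
    (hG : ∀ s x y, G.Adj x y → G.Adj (x + s) (y + s)) :
    ∃ B ∈ thetaFeasible Gᶜ, ∑ x, ∑ y, B x y = lovaszTheta Gᶜ ∧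
      ∀ y, ∑ x, B x y = (Fintype.card V : ℝ)⁻¹ * lovaszTheta Gᶜ := by
  classical
  obtain ⟨B, hB, hs⟩ := exists_sum_eq_lovaszTheta Gᶜ
  let τ (s : V) : G →g G := ⟨fun x => x + s, fun h => hG s _ _ h⟩
  have hpush : ∀ s x y, pushMatrix (τ s) B x y = B (x - s) (y - s) := by
    intro s x y
    have h : ∀ z w : V, τ s z = w ↔ z = w - s := fun z w => eq_sub_iff_add_eq.symm
    simp [pushMatrix, h, ite_and]
  refine ⟨_, average_mem_thetaFeasible fun s => pushMatrix_mem_thetaFeasible (τ s) hB,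
    sum_average fun s => (sum_pushMatrix (τ s) B).trans hs, fun y => ?_⟩
  simp only [Matrix.sum_apply, Matrix.smul_apply, smul_eq_mul, ← Finset.mul_sum, hpush]
  rw [Finset.sum_comm, ← hs]
  congr 1
  -- For fixed `y`, the pair `(x - s, y - s)` runs over all pairs exactly once.
  calc ∑ s, ∑ x, B (x - s) (y - s) = ∑ s, ∑ x, B x (y - s) :=
        Finset.sum_congr rfl fun s _ => (Equiv.subRight s).sum_comp fun x => B x (y - s)
    _ = ∑ x, ∑ s, B x (y - s) := Finset.sum_comm
    _ = ∑ x, ∑ y, B x y :=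
        Finset.sum_congr rfl fun x _ => (Equiv.subLeft y).sum_comp fun z => B x z

end Theta

/-! ### Circular complete graphs and their floor homomorphisms. -/

/-- For `k / d ≤ k' / d'` and `t < k'`, the map `i ↦ ⌊(i k' + t) / k⌋` is a homomorphism from
`K_{k/d}` to `K_{k'/d'}`. -/
def circularHom {k d k' d' : ℕ} (hd' : 1 ≤ d') (h : k * d' ≤ k' * d) (t : ℕ)
    (ht : t < k') : circularCompleteGraph k d →g circularCompleteGraph k' d' where
  toFun i := ⟨(i * k' + t) / k, by
    have hi := i.2
    rw [Nat.div_lt_iff_lt_mul (by omega)]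
    nlinarith⟩
  map_rel' := by
    have key : ∀ i j : Fin k, (j : ℕ) < i → (circularCompleteGraph k d).Adj i j →
        (j * k' + t) / k + d' ≤ (i * k' + t) / k ∧
          (i * k' + t) / k + d' ≤ (j * k' + t) / k + k' := by
      rintro i j hij ⟨-, h1, h2⟩
      have hk : 0 < k := by have := i.2; omega
      rw [abs_of_pos (by omega)] at h1 h2
      have h1' : (j : ℕ) + d ≤ i := by omega
      have h2' : (i : ℕ) + d ≤ j + k := by omega
      -- Moving `d'` and `k'` inside the floors leaves inequalities between numerators, which follow
      -- from `k * d' ≤ k' * d`.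
      rw [← Nat.add_mul_div_left _ d' hk, ← Nat.add_mul_div_left _ d' hk,
        ← Nat.add_mul_div_left _ k' hk]
      exact ⟨Nat.div_le_div_right (by nlinarith), Nat.div_le_div_right (by nlinarith)⟩
    have main : ∀ i j : Fin k, (j : ℕ) < i → (circularCompleteGraph k d).Adj i j →
        (circularCompleteGraph k' d').Adj
          ⟨(i * k' + t) / k, by
            have hi := i.2
            rw [Nat.div_lt_iff_lt_mul (by omega)]
            nlinarith⟩
          ⟨(j * k' + t) / k, by
            have hj := j.2
            rw [Nat.div_lt_iff_lt_mul (by omega)]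
            nlinarith⟩ := by
      intro i j hij hadj
      obtain ⟨h1, h2⟩ := key i j hij hadj
      refine ⟨fun he => ?_, ?_⟩
      · simp only [Fin.mk.injEq] at he
        omega
      · dsimp only
        rw [abs_of_pos (by omega)]
        omega
    intro i j hij
    rcases lt_trichotomy (i : ℕ) j with hlt | heq | hlt
    · exact (main j i hlt hij.symm).symm
    · exact absurd (Fin.ext heq) hij.ne
    · exact main i j hlt hij

@[simp]
theorem circularHom_val {k d k' d' : ℕ} (hd' : 1 ≤ d') (h : k * d' ≤ k' * d) (t : ℕ)
    (ht : t < k') (i : Fin k) : (circularHom hd' h t ht i : ℕ) = (i * k' + t) / k :=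
  rfl

/-- A rotation sends `|x - y|` to itself or to `k - |x - y|`, and the interval `[d, k - d]` is
symmetric under this. -/
theorem circularCompleteGraph_adj_add {k d : ℕ} [NeZero k] (s x y : Fin k)
    (h : (circularCompleteGraph k d).Adj x y) :
    (circularCompleteGraph k d).Adj (x + s) (y + s) := by
  obtain ⟨hne, h1, h2⟩ := h
  refine ⟨fun he => hne (add_right_cancel he), ?_⟩
  have hx := x.2
  have hy := y.2
  have hs := s.2
  rw [Fin.val_add_eq_ite, Fin.val_add_eq_ite]
  rw [le_abs] at *
  rw [abs_le] at *
  split_ifs <;> push_cast [*] <;> omega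

/-- Consecutive maps `i ↦ ⌊(i k + t) / (m k + 1)⌋` differ at the single vertex `m (t + 1)`. -/
theorem eq_of_sum_circularHom_eq_zero {m k d q : ℕ} (hd : 1 ≤ d) (h : (m * k + 1) * d ≤ k * q)
    (v : Fin k → ℝ)
    (hv : ∀ t : Fin k, ∑ x, v (circularHom (k := m * k + 1) (d := q) hd h t t.2 x) = 0) :
    v = 0 := by
  have hstep : ∀ (t : ℕ) (ht : t + 1 < k), v ⟨t + 1, ht⟩ = v ⟨t, by omega⟩ := by
    intro t ht
    have hmt : m * (t + 1) < m * k + 1 := by nlinarith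
    have h1 := hv ⟨t, by omega⟩
    have h2 := hv ⟨t + 1, ht⟩
    have h3 := sub_eq_zero.2 (h2.trans h1.symm)
    rw [← Finset.sum_sub_distrib, Finset.sum_eq_single ⟨m * (t + 1), hmt⟩] at h3
    · have e1 : (m * (t + 1) * k + (t + 1)) / (m * k + 1) = t + 1 :=
        Nat.div_eq_of_eq_mul_left (by omega) (by ring)
      have e2 : (m * (t + 1) * k + t) / (m * k + 1) = t := by
        rw [show m * (t + 1) * k + t = m * k + (m * k + 1) * t by ring,
          Nat.add_mul_div_left _ _ (by omega), Nat.div_eq_of_lt (by omega), zero_add]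
      convert sub_eq_zero.1 h3 using 2
      · exact Fin.ext e1.symm
      · exact Fin.ext e2.symm
    · intro x _ hx
      rw [sub_eq_zero]
      congr 1
      refine Fin.ext ?_
      simp only [circularHom_val]
      rw [← add_assoc, Nat.succ_div, if_neg, add_zero]
      intro hdvd
      have hx2 := x.2
      -- Modulo `m * k + 1`, `k` has inverse `-m`, so `x * k + t + 1 ≡ 0` forces `x ≡ m * (t + 1)`;
      -- both lie in `[0, m * k]`.
      have hdvd' : ((m * k + 1 : ℕ) : ℤ) ∣ (x : ℤ) - m * (t + 1) := by
        have h4 := (Int.natCast_dvd_natCast.2 hdvd).mul_left (m : ℤ)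
        have h5 := dvd_sub (dvd_mul_right ((m * k + 1 : ℕ) : ℤ) x) h4
        have h6 : (x : ℤ) - m * (t + 1) =
            ((m * k + 1 : ℕ) : ℤ) * x - m * ((x * k + t + 1 : ℕ) : ℤ) := by
          push_cast
          ring
        rwa [h6]
      have hpos : (0 : ℤ) ≤ m * (t + 1) := by positivity
      have hzero := Int.eq_zero_of_abs_lt_dvd hdvd' (by
        zify at hmt hx2
        push_cast
        exact abs_lt.2 ⟨by linarith, by linarith⟩)
      refine hx (Fin.ext ?_)
      zify
      linarith
    · simp
  ext j
  have hk : 0 < k := j.pos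
  have hconst : ∀ (t : ℕ) (ht : t < k), v ⟨t, ht⟩ = v ⟨0, hk⟩ := by
    intro t
    induction t with
    | zero => exact fun _ => rfl
    | succ t ih => exact fun ht => (hstep t ht).trans (ih (by omega))
  have hconst' : ∀ x, v x = v ⟨0, hk⟩ := fun x => hconst x x.2
  have h0 := hv j
  rw [Finset.sum_congr rfl fun x _ => hconst' _, Finset.sum_const, Finset.card_univ,
    Fintype.card_fin, nsmul_eq_mul, mul_eq_zero, Nat.cast_eq_zero] at h0
  rw [hconst']
  exact h0.resolve_left (by omega)

theorem lovaszTheta_circularCompleteGraph_lt {k d k' d' : ℕ} (hd : 1 ≤ d) (hd' : 1 ≤ d')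
    (hk : 2 * d ≤ k) (hk' : 2 * d' ≤ k') (h : k * d' < k' * d) :
    lovaszTheta (circularCompleteGraph k d)ᶜ < lovaszTheta (circularCompleteGraph k' d')ᶜ := by
  -- By integrality `k * d' + 1 ≤ k' * d`; multiplying by `m = k` gives enough slack for `h1`.
  set m := k with hm
  have h1 : k * (m * d' + 1) ≤ (m * k' + 1) * d := by nlinarith
  have h2 : (m * k' + 1) * d' ≤ k' * (m * d' + 1) := by nlinarith
  have : NeZero k := ⟨by omega⟩
  have : NeZero k' := ⟨by omega⟩
  refine (lovaszTheta_compl_le_of_hom (circularHom (by omega) h1 0 (by omega))).trans_lt ?_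
  obtain ⟨B, hB, hopt, hrow⟩ := exists_optimal_const_sum
    (G := circularCompleteGraph (m * k' + 1) (m * d' + 1)) circularCompleteGraph_adj_add
  refine lovaszTheta_compl_lt_of_homs (fun t : Fin k' => circularHom hd' h2 t t.2)
    (eq_of_sum_circularHom_eq_zero hd' h2) hB hopt
    (mul_ne_zero (by positivity) (lovaszTheta_pos _).ne') hrow
    -- The pair `d'`, `0` is an edge because `2 * d' ≤ k'`.
    (a := ⟨d', by omega⟩) (b := ⟨0, by omega⟩) ⟨?_, ?_⟩
  · simp only [ne_eq, Fin.mk.injEq]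
    omega
  · dsimp only
    rw [abs_of_nonneg (by omega)]
    omega

theorem mainTheorem4 (k d k' d' : ℕ) (hd : 1 ≤ d) (hd' : 1 ≤ d')
    (hk : 2 * d ≤ k) (hk' : 2 * d' ≤ k')
    (h : lovaszTheta (circularCompleteGraph k d)ᶜ =
      lovaszTheta (circularCompleteGraph k' d')ᶜ) :
    (k : ℚ) / (d : ℚ) = (k' : ℚ) / (d' : ℚ) := by
  have hd0 : (d : ℚ) ≠ 0 := by positivity
  have hd0' : (d' : ℚ) ≠ 0 := by positivity
  rw [div_eq_div_iff hd0 hd0']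
  rcases lt_trichotomy (k * d') (k' * d) with hlt | heq | hlt
  · exact absurd h (lovaszTheta_circularCompleteGraph_lt hd hd' hk hk' hlt).ne
  · exact_mod_cast heq
  · exact absurd h (lovaszTheta_circularCompleteGraph_lt hd' hd hk' hk hlt).ne'
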